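/- Let $N\ge 2$ be an integer and let $T_N$ denote the map $x\mapsto Nx \bmod 1$ on $[0,1]$ and also the map $(x_1,x_2)\mapsto (Nx_1 \bmod 1, Nx_2\bmod 1)$ on $[0,1]^2$, where $\bmod\ 1$ takes values in $[0,1)$. For a Borel probability measure $\mu$ on a metric space, let $\dim_H\mu=\inf\{\dim_H A:\ A \text{ Borel},\ \mu(A)>0\}$ be its (lower) Hausdorff dimension. For $v=(v_1,v_2)\in\mathbb R^2$ let $P_v\mu$ be the push-forward of $\mu$ under $P_v(x)=\langle x,v\rangle = x_1v_1+x_2v_2$, and call $v$ non-principal if $v_1v_2\ne 0$. Let $\lambda$ be Lebesgue measure on $[0,1]$. Let $\mu$ be a $T_N$-invariant and ergodic Borel probability measure on $[0,1]^2$ with $\dim_H\mu=1$. Then the following are equivalent: 1. $\dim_H P_v\mu=1$ (that is, $\dim_H P_v\mu=\dim_H\mu$) for all non-principal $v\in\mathbb R^2$; 2. $\mu=\nu\times\lambda$ or $\mu=\lambda\times\nu$ for some $T_N$-invariant and ergodic Borel probability measure $\nu$ on $[0,1]$ with $\dim_H\nu=0$. -/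

import Mathlib

open MeasureTheory
open scoped ENNReal unitInterval

namespace TimesN

/-- The map `x ↦ N x mod 1` on `[0,1]`, where `mod 1` takes values in `[0,1)`. -/
noncomputable def timesMap (N : ℕ) (x : I) : I :=
  ⟨Int.fract ((N : ℝ) * (x : ℝ)), Int.fract_nonneg _, (Int.fract_lt_one _).le⟩

/-- The map `(x₁, x₂) ↦ (N x₁ mod 1, N x₂ mod 1)` on `[0,1]²`. -/
noncomputable def timesMap₂ (N : ℕ) (x : I × I) : I × I :=
  (timesMap N x.1, timesMap N x.2)

/-- The projection `P_v(x) = ⟨x, v⟩`, as a map from `[0,1]²` to `ℝ`. -/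
def proj (v : ℝ × ℝ) (x : I × I) : ℝ :=
  (x.1 : ℝ) * v.1 + (x.2 : ℝ) * v.2

/-- A vector of the plane is non-principal if it lies on neither coordinate axis. -/
def NonPrincipal (v : ℝ × ℝ) : Prop :=
  v.1 * v.2 ≠ 0

/-- The (lower) Hausdorff dimension of a Borel measure: the infimum of the Hausdorff dimensions
of the Borel sets of positive measure. On `[0,1]²` Mathlib's metric is the maximum metric; it is
bi-Lipschitz equivalent to the Euclidean one, so both give the same Hausdorff dimensions. -/
noncomputable def measureDimH {X : Type*} [EMetricSpace X] [MeasurableSpace X] [BorelSpace X]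
    (μ : Measure X) : ℝ≥0∞ :=
  ⨅ (A : Set X) (_ : MeasurableSet A) (_ : 0 < μ A), dimH A

theorem measurable_timesMap (N : ℕ) : Measurable (timesMap N) :=
  (measurable_fract.comp (measurable_subtype_coe.const_mul (N : ℝ))).subtype_mk

theorem measurable_timesMap₂ (N : ℕ) : Measurable (timesMap₂ N) :=
  ((measurable_timesMap N).comp measurable_fst).prodMk
    ((measurable_timesMap N).comp measurable_snd)

theorem measurable_proj (v : ℝ × ℝ) : Measurable (proj v) := by
  unfold proj
  fun_prop

end TimesN

/-!
Among the `×N`-invariant probability measures on `[0,1]` only Lebesgue measure has dimension `1`: if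
the first digit in some base `N ^ n` is not uniformly distributed, the digit frequencies confine a
set of positive measure to few cylinders. For integers `p, q ≠ 0` the map `x ↦ p x₁ + q x₂ mod 1`
commutes with multiplication by `N` and does not decrease the dimension of `P_v μ`, `v = (p, q)`, so
it sends `μ` to `λ`; thus all mixed Fourier coefficients of `μ` vanish, which says
`μ + λ × λ = μ₁ × λ + λ × μ₂` with `μ₁, μ₂` the marginals of `μ`. If neither marginal is `λ`, both
are singular by ergodicity, hence live on `λ`-null sets `A₁, A₂`; the right-hand side does not
charge `A₁ × A₂`, which carries all of `μ`. If one marginal is `λ`, cancelling gives a product, and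
slicing computes the dimension of the other factor. Conversely, the non-principal projections of
`ν × λ` and `λ × ν` are absolutely continuous.
-/

namespace TimesN

open Filter Topology Set
open scoped NNReal

section LowerDimension

variable {X Y : Type*} [EMetricSpace X] [EMetricSpace Y]

theorem dimH_preimage_iterate_le {T : X → X} (hT : ∀ A, dimH (T ⁻¹' A) ≤ dimH A) (n : ℕ)
    (A : Set X) : dimH (T^[n] ⁻¹' A) ≤ dimH A := by
  induction n with
  | zero => exact le_rfl
  | succ n ih =>
    rw [Function.iterate_succ, preimage_comp]
    exact (hT _).trans ih

variable [MeasurableSpace X] [BorelSpace X] [MeasurableSpace Y] [BorelSpace Y] {m m' : Measure X}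

theorem measureDimH_le_dimH {A : Set X} (hA : MeasurableSet A) (hpos : 0 < m A) :
    measureDimH m ≤ dimH A :=
  iInf₂_le_of_le A hA (iInf_le _ hpos)

theorem le_measureDimH_iff {d : ℝ≥0∞} :
    d ≤ measureDimH m ↔ ∀ A, MeasurableSet A → 0 < m A → d ≤ dimH A := by
  simp only [measureDimH, le_iInf_iff]

theorem measureDimH_lt_iff {d : ℝ≥0∞} :
    measureDimH m < d ↔ ∃ A, MeasurableSet A ∧ 0 < m A ∧ dimH A < d := by
  simp only [measureDimH, iInf_lt_iff, exists_prop]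

theorem measure_eq_zero_of_dimH_lt_measureDimH {A : Set X} (hA : MeasurableSet A)
    (h : dimH A < measureDimH m) : m A = 0 :=
  of_not_not fun hne ↦ (measureDimH_le_dimH hA (pos_iff_ne_zero.2 hne)).not_gt h

theorem measureDimH_le_of_absolutelyContinuous (h : m ≪ m') :
    measureDimH m' ≤ measureDimH m :=
  le_measureDimH_iff.2 fun _ hA hpos ↦
    measureDimH_le_dimH hA (pos_iff_ne_zero.2 fun h0 ↦ hpos.ne' (h h0))

theorem measureDimH_le_measureDimH_map {f : X → Y} (hf : Measurable f)
    (hdim : ∀ A, dimH (f ⁻¹' A) ≤ dimH A) (m : Measure X) :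
    measureDimH m ≤ measureDimH (m.map f) :=
  le_measureDimH_iff.2 fun A hA hpos ↦
    (measureDimH_le_dimH (hf hA) (by rwa [Measure.map_apply hf hA] at hpos)).trans (hdim A)

theorem mutuallySingular_of_ergodic_of_measureDimH_lt [IsFiniteMeasure m] {T : X → X}
    (hm : Ergodic T m) (hT : ∀ A, dimH (T ⁻¹' A) ≤ dimH A)
    (h : measureDimH m < measureDimH m') : m ⟂ₘ m' := by
  obtain ⟨A, hA, hpos, hdim⟩ := measureDimH_lt_iff.1 h
  have hBm : MeasurableSet (⋃ n, T^[n] ⁻¹' A) :=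
    .iUnion fun n ↦ hm.measurable.iterate n hA
  have hBsub : T ⁻¹' (⋃ n, T^[n] ⁻¹' A) ⊆ ⋃ n, T^[n] ⁻¹' A := by
    rw [preimage_iUnion]
    exact iUnion_subset fun n ↦ subset_iUnion_of_subset (n + 1) le_rfl
  have hBdim : dimH (⋃ n, T^[n] ⁻¹' A) < measureDimH m' := by
    rw [dimH_iUnion]
    exact (iSup_le fun n ↦ dimH_preimage_iterate_le hT n A).trans_lt hdim
  refine Measure.MutuallySingular.symm
    ⟨_, hBm, measure_eq_zero_of_dimH_lt_measureDimH hBm hBdim, ?_⟩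
  rcases hm.ae_empty_or_univ_of_preimage_ae_le hBm.nullMeasurableSet
    (Eventually.of_forall hBsub) with h0 | h0
  · exact absurd (measure_mono_null (subset_iUnion (T^[·] ⁻¹' A) 0) (ae_eq_empty.1 h0)) hpos.ne'
  · exact ae_eq_univ.1 h0

end LowerDimension

section Covers

variable {X : Type*} [EMetricSpace X]

theorem dimH_le_of_frequently_mem_cover {s : ℝ≥0} (hs : 0 < s) {κ : ℕ → Type*}
    [∀ n, Countable (κ n)] (U : ∀ n, κ n → Set X)
    (hU : ∑' n, ∑' i, Metric.ediam (U n i) ^ (s : ℝ) ≠ ⊤) :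
    dimH {x | ∃ᶠ n in atTop, ∃ i, x ∈ U n i} ≤ s := by
  borelize X
  let tail : ℕ → ℝ≥0∞ := fun n ↦ ∑' k, ∑' i, Metric.ediam (U (k + n) i) ^ (s : ℝ)
  have htail : Tendsto tail atTop (𝓝 0) := ENNReal.tendsto_sum_nat_add _ hU
  have hle (n : ℕ) (p : Σ k, κ (k + n)) : Metric.ediam (U (p.1 + n) p.2) ^ (s : ℝ) ≤ tail n :=
    (ENNReal.le_tsum p.2).trans
      (ENNReal.le_tsum (f := fun k ↦ ∑' i, Metric.ediam (U (k + n) i) ^ (s : ℝ)) p.1)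
  have hH := Measure.hausdorffMeasure_le_liminf_tsum (s : ℝ)
    {x | ∃ᶠ n in atTop, ∃ i, x ∈ U n i} (fun n ↦ tail n ^ (s : ℝ)⁻¹)
    (by simpa [hs] using htail.ennrpow_const (s : ℝ)⁻¹)
    (fun n (p : Σ k, κ (k + n)) ↦ U (p.1 + n) p.2)
    (Eventually.of_forall fun n p ↦ (ENNReal.le_rpow_inv_iff (by exact_mod_cast hs)).2 (hle n p))
    (Eventually.of_forall fun n x hx ↦ by
      obtain ⟨k, hk, i, hi⟩ := frequently_atTop.1 hx n
      obtain ⟨k, rfl⟩ := Nat.exists_eq_add_of_le' hk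
      exact mem_iUnion.2 ⟨⟨k, i⟩, hi⟩)
  simp_rw [ENNReal.tsum_sigma'] at hH
  refine dimH_le_of_hausdorffMeasure_ne_top (ne_top_of_le_ne_top ENNReal.zero_ne_top ?_)
  exact hH.trans_eq htail.liminf_eq

theorem exists_cover_tsum_ediam_rpow_lt {s : ℝ≥0} (hs : 0 < s) {A : Set X} (hA : dimH A < s)
    {ε : ℝ≥0∞} (hε : 0 < ε) :
    ∃ U : ℕ → Set X, A ⊆ ⋃ i, U i ∧ ∑' i, Metric.ediam (U i) ^ (s : ℝ) < ε := by
  borelize X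
  have h0 := hausdorffMeasure_of_dimH_lt hA
  rw [Measure.hausdorffMeasure_apply] at h0
  have h1 := (iSup_eq_bot.1 (iSup_eq_bot.1 h0 1) one_pos).trans_lt hε
  simp only [iInf_lt_iff] at h1
  obtain ⟨U, hAU, -, hU⟩ := h1
  refine ⟨U, hAU, (ENNReal.tsum_le_tsum fun i ↦ ?_).trans_lt hU⟩
  rcases (U i).eq_empty_or_nonempty with h | h
  · simp [h, hs]
  · exact le_iSup_of_le h le_rfl

theorem exists_seq_cover_of_dimH_lt {s : ℝ≥0} (hs : 0 < s) {A : Set X} (hA : dimH A < s) :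
    ∃ U : ℕ → ℕ → Set X, (∀ n, A ⊆ ⋃ i, U n i) ∧
      ∑' n, ∑' i, Metric.ediam (U n i) ^ (s : ℝ) ≠ ⊤ := by
  obtain ⟨ε, hε, hεs⟩ := ENNReal.exists_pos_sum_of_countable' one_ne_zero ℕ
  choose U hAU hU using fun n ↦ exists_cover_tsum_ediam_rpow_lt hs hA (hε n)
  exact ⟨U, hAU, ((ENNReal.tsum_le_tsum fun n ↦ (hU n).le).trans_lt
    (hεs.trans ENNReal.one_lt_top)).ne⟩

end Covers

section Frostman

variable {X Y : Type*} [EMetricSpace X] [EMetricSpace Y] [MeasurableSpace X]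

/-- The Frostman condition (mass distribution principle) with exponent `d`: the mass of a set is at
most a constant times the `d`-th power of its diameter. It bounds dimensions from below. -/
def IsFrostman (d : ℝ≥0) (m : Measure X) : Prop :=
  ∃ C : ℝ≥0, ∀ s : Set X, m s ≤ C * Metric.ediam s ^ (d : ℝ)

variable {d : ℝ≥0} {m : Measure X}

theorem IsFrostman.measure_eq_zero (hm : IsFrostman d m) {A : Set X} (hA : dimH A < d) :
    m A = 0 := by
  obtain ⟨C, hC⟩ := hm
  obtain ⟨U, hAU, hU⟩ := exists_seq_cover_of_dimH_lt (ENNReal.coe_pos.1 hA.pos) hA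
  have hlim := ENNReal.Tendsto.const_mul (a := C) (ENNReal.tendsto_atTop_zero_of_tsum_ne_top hU)
    (.inr ENNReal.coe_ne_top)
  rw [mul_zero] at hlim
  refine le_antisymm (ge_of_tendsto' hlim fun n ↦ ?_) zero_le
  calc m A ≤ ∑' i, m (U n i) := (measure_mono (hAU n)).trans (measure_iUnion_le _)
    _ ≤ ∑' i, C * Metric.ediam (U n i) ^ (d : ℝ) := ENNReal.tsum_le_tsum fun i ↦ hC _
    _ = C * ∑' i, Metric.ediam (U n i) ^ (d : ℝ) := ENNReal.tsum_mul_left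

variable [BorelSpace X]

theorem IsFrostman.le_measureDimH (hm : IsFrostman d m) : d ≤ measureDimH m :=
  le_measureDimH_iff.2 fun _ _ hpos ↦ le_of_not_gt fun hlt ↦ hpos.ne' (hm.measure_eq_zero hlt)

theorem exists_measurable_ediam_slice_rpow_le {C : ℝ≥0}
    (hC : ∀ s : Set X, m s ≤ C * Metric.ediam s ^ (d : ℝ)) {t : ℝ≥0} (ht : 0 < t)
    (U : Set (X × Y)) :
    ∃ g : X → ℝ≥0∞, Measurable g ∧ (∀ x, Metric.ediam (Prod.mk x ⁻¹' U) ^ (t : ℝ) ≤ g x) ∧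
      ∫⁻ x, g x ∂m ≤ C * Metric.ediam U ^ ((d + t : ℝ≥0) : ℝ) := by
  have hK : MeasurableSet (closure (Prod.fst '' U)) := isClosed_closure.measurableSet
  refine ⟨(closure (Prod.fst '' U)).indicator fun _ ↦ Metric.ediam U ^ (t : ℝ),
    measurable_const.indicator hK, fun x ↦ ?_, ?_⟩
  · by_cases hx : x ∈ Prod.fst '' U
    · rw [indicator_of_mem (subset_closure hx)]
      gcongr
      refine Metric.ediam_le fun y hy z hz ↦ ?_
      simpa [Prod.edist_eq] using Metric.edist_le_ediam_of_mem (s := U) hy hz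
    · have hempty : Prod.mk x ⁻¹' U = ∅ :=
        eq_empty_of_forall_notMem fun y hy ↦ hx ⟨_, hy, rfl⟩
      simp [hempty, ht]
  · have hdiam : Metric.ediam (closure (Prod.fst '' U)) ≤ Metric.ediam U := by
      simpa [Metric.ediam_closure] using (LipschitzWith.prod_fst (β := Y)).ediam_image_le U
    rw [lintegral_indicator_const hK, NNReal.coe_add,
      ENNReal.rpow_add_of_nonneg _ _ d.coe_nonneg t.coe_nonneg, mul_comm, ← mul_assoc]
    gcongr
    exact (hC _).trans (by gcongr)

theorem IsFrostman.ae_dimH_slice_le (hm : IsFrostman d m) {t : ℝ≥0} (ht : 0 < t)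
    {A : Set (X × Y)} (hA : dimH A < d + t) : ∀ᵐ x ∂m, dimH (Prod.mk x ⁻¹' A) ≤ t := by
  obtain ⟨C, hC⟩ := hm
  obtain ⟨U, hAU, hU⟩ := exists_seq_cover_of_dimH_lt (s := d + t) (by positivity)
    (by simpa using hA)
  choose g hgm hUg hg using fun n i ↦ exists_measurable_ediam_slice_rpow_le hC ht (U n i)
  have hgsum : ∫⁻ x, ∑' n, ∑' i, g n i x ∂m ≠ ⊤ := by
    refine ne_top_of_le_ne_top (ENNReal.mul_ne_top (ENNReal.coe_ne_top (r := C)) hU) ?_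
    rw [lintegral_tsum fun n ↦ (Measurable.tsum fun i ↦ hgm n i).aemeasurable,
      ← ENNReal.tsum_mul_left]
    refine ENNReal.tsum_le_tsum fun n ↦ ?_
    rw [lintegral_tsum fun i ↦ (hgm n i).aemeasurable, ← ENNReal.tsum_mul_left]
    exact ENNReal.tsum_le_tsum fun i ↦ hg n i
  filter_upwards [ae_lt_top (.tsum fun n ↦ .tsum fun i ↦ hgm n i) hgsum] with x hx
  refine (dimH_mono fun y hy ↦ ?_).trans (dimH_le_of_frequently_mem_cover ht
    (fun n i ↦ Prod.mk x ⁻¹' U n i) (ne_top_of_le_ne_top hx.ne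
      (ENNReal.tsum_le_tsum fun n ↦ ENNReal.tsum_le_tsum fun i ↦ hUg n i x)))
  exact (Eventually.of_forall fun n ↦ mem_iUnion.1 (hAU n hy)).frequently

theorem IsFrostman.add_measureDimH_le_measureDimH_prod [MeasurableSpace Y] [BorelSpace Y]
    [SecondCountableTopologyEither X Y] (hm : IsFrostman d m) (ν : Measure Y) [SFinite ν] :
    d + measureDimH ν ≤ measureDimH (m.prod ν) := by
  refine le_measureDimH_iff.2 fun A hA hpos ↦ le_of_not_gt fun hlt ↦ hpos.ne' ?_
  rcases lt_or_ge (dimH A) d with hd | hd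
  · have hfst : m (Prod.fst '' A) = 0 :=
      hm.measure_eq_zero ((LipschitzWith.prod_fst.dimH_image_le A).trans_lt hd)
    refine measure_mono_null (t := (Prod.fst '' A) ×ˢ univ)
      (fun p hp ↦ ⟨mem_image_of_mem _ hp, mem_univ p.2⟩) ?_
    rw [Measure.prod_prod, hfst, zero_mul]
  · obtain ⟨t, hAt, ht⟩ := ENNReal.lt_iff_exists_nnreal_btwn.1
      ((ENNReal.sub_lt_iff_lt_left ENNReal.coe_ne_top hd).2 hlt)
    refine (Measure.measure_prod_null hA).2 ?_
    filter_upwards [hm.ae_dimH_slice_le (ENNReal.coe_pos.1 hAt.pos)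
      (ENNReal.lt_add_of_sub_lt_left (.inr ENNReal.coe_ne_top) hAt)] with x hx
    exact measure_eq_zero_of_dimH_lt_measureDimH (measurable_prodMk_left hA) (hx.trans_lt ht)

end Frostman

theorem isFrostman_volume_real : IsFrostman 1 (volume : Measure ℝ) :=
  ⟨1, fun s ↦ by simpa using Real.volume_le_diam s⟩

theorem isFrostman_volume_unitInterval : IsFrostman 1 (volume : Measure I) :=
  ⟨1, fun s ↦ by
    simpa [unitInterval.volume_apply, isometry_subtype_coe.ediam_image] using
      Real.volume_le_diam (Subtype.val '' s)⟩

section Coding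

variable {X Y ι : Type*} {T : X → X} {c : X → ι} {r : ℝ≥0}

/-- The set of points whose orbit under `T` starts with the itinerary `u` in the code `c`. -/
def cylinder (T : X → X) (c : X → ι) {k : ℕ} (u : Fin k → ι) : Set X :=
  {x | ∀ j : Fin k, c (T^[j] x) = u j}

theorem birkhoffSum_comp_eq_sum_of_mem_cylinder {k : ℕ} {u : Fin k → ι} {x : X}
    (hx : x ∈ cylinder T c u) (f : ι → ℝ) : birkhoffSum T (f ∘ c) k x = ∑ j, f (u j) := by
  rw [birkhoffSum, Finset.sum_range]
  exact Finset.sum_congr rfl fun j _ ↦ congrArg f (hx j)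

variable [EMetricSpace X] [EMetricSpace Y]

/-- On each level set of the code `c`, the map `f` contracts distances at most by the factor `K`,
that is, it expands them at least by the factor `K⁻¹`. The examples are `x ↦ N x mod 1`, coded by
digits, and `x ↦ x mod 1`, coded by integer parts. -/
def PiecewiseAntilipschitzWith (K : ℝ≥0) (c : X → ι) (f : X → Y) : Prop :=
  ∀ ⦃x y⦄, c x = c y → edist x y ≤ K * edist (f x) (f y)

theorem PiecewiseAntilipschitzWith.dimH_preimage_le [Countable ι] {f : X → Y}
    (hf : PiecewiseAntilipschitzWith r c f) (A : Set Y) : dimH (f ⁻¹' A) ≤ dimH A := by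
  have hcover : f ⁻¹' A = ⋃ i, Subtype.val '' ((fun x : c ⁻¹' {i} ↦ f x) ⁻¹' A) := by
    ext x
    simp
  rw [hcover, dimH_iUnion]
  refine iSup_le fun i ↦ ?_
  have hanti : AntilipschitzWith r fun x : c ⁻¹' {i} ↦ f x := fun x y ↦ hf (x.2.trans y.2.symm)
  rw [isometry_subtype_coe.dimH_image]
  exact hanti.dimH_preimage_le A

theorem PiecewiseAntilipschitzWith.edist_le_pow_mul (hT : PiecewiseAntilipschitzWith r c T)
    {x y : X} {k : ℕ} (h : ∀ j < k, c (T^[j] x) = c (T^[j] y)) :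
    edist x y ≤ r ^ k * edist (T^[k] x) (T^[k] y) := by
  induction k with
  | zero => simp
  | succ k ih =>
    calc edist x y ≤ r ^ k * edist (T^[k] x) (T^[k] y) :=
          ih fun j hj ↦ h j (hj.trans k.lt_succ_self)
      _ ≤ r ^ k * (r * edist (T (T^[k] x)) (T (T^[k] y))) := by
          gcongr
          exact hT (h k k.lt_succ_self)
      _ = r ^ (k + 1) * edist (T^[k + 1] x) (T^[k + 1] y) := by
        rw [Function.iterate_succ_apply', Function.iterate_succ_apply', pow_succ, mul_assoc]

theorem PiecewiseAntilipschitzWith.ediam_cylinder_le (hT : PiecewiseAntilipschitzWith r c T)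
    {k : ℕ} (u : Fin k → ι) :
    Metric.ediam (cylinder T c u) ≤ r ^ k * Metric.ediam (univ : Set X) :=
  Metric.ediam_le fun x hx y hy ↦
    (hT.edist_le_pow_mul fun j hj ↦ (hx ⟨j, hj⟩).trans (hy ⟨j, hj⟩).symm).trans
      (by gcongr; exact Metric.edist_le_ediam_of_mem (mem_univ _) (mem_univ _))

theorem PiecewiseAntilipschitzWith.ediam_rpow_le_prod (hT : PiecewiseAntilipschitzWith r c T)
    (f : ι → ℝ) (a : ℝ) {t : ℝ≥0} (ht : 0 < t) {k : ℕ} (u : Fin k → ι) :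
    Metric.ediam {x ∈ cylinder T c u | k * a ≤ birkhoffSum T (f ∘ c) k x} ^ (t : ℝ) ≤
      Metric.ediam (univ : Set X) ^ (t : ℝ) *
        ∏ j, ((r : ℝ≥0∞) ^ (t : ℝ) * ENNReal.ofReal (Real.exp (f (u j) - a))) := by
  rcases {x ∈ cylinder T c u | k * a ≤ birkhoffSum T (f ∘ c) k x}.eq_empty_or_nonempty with
    h | ⟨x, hx, hxa⟩
  · simp [h, ht]
  have hweight : 1 ≤ ∏ j, ENNReal.ofReal (Real.exp (f (u j) - a)) := by
    rw [← ENNReal.ofReal_prod_of_nonneg fun j _ ↦ (Real.exp_pos _).le, ← Real.exp_sum,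
      ENNReal.one_le_ofReal, Real.one_le_exp_iff, Finset.sum_sub_distrib,
      ← birkhoffSum_comp_eq_sum_of_mem_cylinder hx]
    simpa using hxa
  calc _ ≤ (r ^ k * Metric.ediam (univ : Set X)) ^ (t : ℝ) := by
        gcongr
        exact (Metric.ediam_mono (sep_subset _ _)).trans (hT.ediam_cylinder_le u)
    _ = Metric.ediam (univ : Set X) ^ (t : ℝ) * (((r : ℝ≥0∞) ^ (t : ℝ)) ^ k * 1) := by
        rw [ENNReal.mul_rpow_of_nonneg _ _ t.coe_nonneg, mul_comm, mul_one,
          ← ENNReal.rpow_natCast_mul, ← ENNReal.rpow_mul_natCast, mul_comm (k : ℝ)]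
    _ ≤ _ := by
        rw [Finset.prod_mul_distrib, Finset.prod_const, Finset.card_univ, Fintype.card_fin]
        gcongr

theorem PiecewiseAntilipschitzWith.dimH_frequently_le_birkhoffSum_le
    (hT : PiecewiseAntilipschitzWith r c T) (hX : Metric.ediam (univ : Set X) ≠ ⊤) (s : Finset ι)
    (f : ι → ℝ) (a : ℝ) {t : ℝ≥0} (ht : 0 < t)
    (hs : (∑ d ∈ s, Real.exp (f d - a)) * (r : ℝ) ^ (t : ℝ) < 1) :
    dimH {x | (∀ j, c (T^[j] x) ∈ s) ∧ ∃ᶠ k : ℕ in atTop, k * a ≤ birkhoffSum T (f ∘ c) k x} ≤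
      t := by
  let w : s → ℝ≥0∞ := fun d ↦ (r : ℝ≥0∞) ^ (t : ℝ) * ENNReal.ofReal (Real.exp (f d - a))
  have hw : ∑ d, w d < 1 := by
    rw [← Finset.mul_sum, ← ENNReal.ofReal_sum_of_nonneg fun d _ ↦ (Real.exp_pos _).le,
      ← ENNReal.ofReal_coe_nnreal, ENNReal.ofReal_rpow_of_nonneg r.coe_nonneg t.coe_nonneg,
      ← ENNReal.ofReal_mul (by positivity), ENNReal.ofReal_lt_one,
      Finset.sum_coe_sort s (fun d ↦ Real.exp (f d - a)), mul_comm]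
    exact hs
  let U (k : ℕ) (u : Fin k → s) : Set X :=
    {x ∈ cylinder T c fun j ↦ (u j : ι) | k * a ≤ birkhoffSum T (f ∘ c) k x}
  have hU (k : ℕ) : ∑' u, Metric.ediam (U k u) ^ (t : ℝ) ≤
      Metric.ediam (univ : Set X) ^ (t : ℝ) * (∑ d, w d) ^ k := by
    rw [Fintype.sum_pow, Finset.mul_sum, tsum_fintype]
    exact Finset.sum_le_sum fun u _ ↦ hT.ediam_rpow_le_prod f a ht _
  refine (dimH_mono fun x hx ↦ ?_).trans (dimH_le_of_frequently_mem_cover ht U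
    (ne_top_of_le_ne_top ?_ (ENNReal.tsum_le_tsum hU)))
  · exact hx.2.mono fun k hk ↦ ⟨fun j ↦ ⟨_, hx.1 j⟩, fun j ↦ rfl, hk⟩
  · rw [ENNReal.tsum_mul_left, ENNReal.tsum_geometric]
    exact ENNReal.mul_ne_top (ENNReal.rpow_ne_top_of_nonneg t.coe_nonneg hX)
      (ENNReal.inv_ne_top.2 (tsub_pos_of_lt hw).ne')

end Coding

section BirkhoffSums

variable {α : Type*} [MeasurableSpace α] {m : Measure α} {T : α → α} {f : α → ℝ}

theorem measure_limsup_pos_of_frequently_le [IsFiniteMeasure m] {E : ℕ → Set α}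
    (hE : ∀ k, NullMeasurableSet (E k) m) {δ : ℝ≥0∞} (hδ : 0 < δ)
    (h : ∃ᶠ k in atTop, δ ≤ m (E k)) : 0 < m (limsup E atTop) := by
  rw [limsup_eq_iInf_iSup_of_nat]
  refine hδ.trans_le (ge_of_tendsto' (tendsto_measure_iInter_atTop
    (fun n ↦ .iUnion fun k ↦ .iUnion fun _ ↦ hE k)
    (fun a b hab ↦ biUnion_subset_biUnion_left fun k ↦ hab.trans) ⟨0, measure_ne_top _ _⟩)
    fun n ↦ ?_)
  obtain ⟨k, hk, hδk⟩ := frequently_atTop.1 h n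
  exact hδk.trans (measure_mono (subset_iUnion₂_of_subset k hk le_rfl))

theorem integrable_comp_iterate (hT : MeasurePreserving T m m) (hf : Integrable f m) (j : ℕ) :
    Integrable (fun x ↦ f (T^[j] x)) m :=
  (hT.iterate j).integrable_comp_of_integrable hf

theorem integrable_birkhoffSum (hT : MeasurePreserving T m m) (hf : Integrable f m) (k : ℕ) :
    Integrable (birkhoffSum T f k) m :=
  integrable_finsetSum _ fun j _ ↦ integrable_comp_iterate hT hf j

theorem integral_birkhoffSum (hT : MeasurePreserving T m m) (hf : Integrable f m) (k : ℕ) :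
    ∫ x, birkhoffSum T f k x ∂m = k * ∫ x, f x ∂m := by
  have hj (j : ℕ) : ∫ x, f (T^[j] x) ∂m = ∫ x, f x ∂m := by
    have hTj := hT.iterate j
    rw [← integral_map hTj.aemeasurable (by rw [hTj.map_eq]; exact hf.aestronglyMeasurable),
      hTj.map_eq]
  simp [birkhoffSum, integral_finsetSum _ fun j _ ↦ integrable_comp_iterate hT hf j, hj]

theorem ae_birkhoffSum_le (hT : MeasurePreserving T m m) {B : ℝ} (hB : ∀ᵐ x ∂m, f x ≤ B)
    (k : ℕ) : ∀ᵐ x ∂m, birkhoffSum T f k x ≤ k * B := by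
  have hj (j : ℕ) : ∀ᵐ x ∂m, f (T^[j] x) ≤ B := (hT.iterate j).quasiMeasurePreserving.ae hB
  filter_upwards [ae_all_iff.2 hj] with x hx
  simpa [birkhoffSum] using Finset.sum_le_card_nsmul (Finset.range k) (fun j ↦ f (T^[j] x)) B
    fun j _ ↦ hx j

theorem integral_le_add_mul_measureReal [IsProbabilityMeasure m] (hf : Integrable f m) {B : ℝ}
    (hB : ∀ᵐ x ∂m, f x ≤ B) (a : ℝ) :
    ∫ x, f x ∂m ≤ a + (B - a) * m.real {x | a ≤ f x} := by
  have hE : NullMeasurableSet {x | a ≤ f x} m :=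
    nullMeasurableSet_le aemeasurable_const hf.aemeasurable
  have hind : Integrable ({x | a ≤ f x}.indicator fun _ ↦ B - a) m :=
    (integrable_const (B - a)).indicator₀ hE
  calc ∫ x, f x ∂m ≤ ∫ x, a + {x | a ≤ f x}.indicator (fun _ ↦ B - a) x ∂m := by
        refine integral_mono_ae hf ((integrable_const a).add hind) ?_
        filter_upwards [hB] with x hx
        by_cases h : a ≤ f x
        · simpa [h] using hx
        · simpa [h] using (not_le.1 h).le
    _ = a + (B - a) * m.real {x | a ≤ f x} := by
        rw [integral_add (integrable_const a) hind, integral_indicator₀ hE, setIntegral_const]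
        simp [mul_comm]

theorem measure_limsup_le_birkhoffSum_pos [IsProbabilityMeasure m]
    (hT : MeasurePreserving T m m) (hf : Integrable f m) {B : ℝ} (hB : ∀ᵐ x ∂m, f x ≤ B) {a : ℝ}
    (ha : a < ∫ x, f x ∂m) :
    0 < m (limsup (fun k : ℕ ↦ {x | k * a ≤ birkhoffSum T f k x}) atTop) := by
  have haB : a < B := ha.trans_le (by simpa using integral_mono_ae hf (integrable_const B) hB)
  refine measure_limsup_pos_of_frequently_le
    (fun k ↦ nullMeasurableSet_le aemeasurable_const (integrable_birkhoffSum hT hf k).aemeasurable)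
    (δ := ENNReal.ofReal ((∫ x, f x ∂m - a) / (B - a)))
    (ENNReal.ofReal_pos.2 (div_pos (sub_pos.2 ha) (sub_pos.2 haB)))
    ((eventually_gt_atTop 0).mono fun k hk ↦ ?_).frequently
  refine ENNReal.ofReal_le_of_le_toReal ((div_le_iff₀' (sub_pos.2 haB)).2 ?_)
  have hmean := integral_le_add_mul_measureReal (integrable_birkhoffSum hT hf k)
    (ae_birkhoffSum_le hT hB k) (k * a)
  rw [integral_birkhoffSum hT hf] at hmean
  refine le_of_mul_le_mul_left (a := (k : ℝ)) ?_ (Nat.cast_pos.2 hk)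
  rw [← measureReal_def]
  linarith

end BirkhoffSums

section Entropy

variable {ι : Type*}

/-- A regularised relative entropy weight of the symbol `i` with respect to the uniform distribution
on the `M` symbols of `s`: the usual weight `log (M p)` is unbounded below, hence the `+ 1`. -/
noncomputable def gibbsWeight (s : Finset ι) (p : ι → ℝ) (i : ι) : ℝ :=
  Real.log ((s.card * p i + 1) / 2)

variable {s : Finset ι} {p : ι → ℝ}

theorem sum_exp_gibbsWeight (hp : ∀ i, 0 ≤ p i) (hsum : ∑ i ∈ s, p i = 1) :
    ∑ i ∈ s, Real.exp (gibbsWeight s p i) = s.card := by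
  have hexp (i : ι) : Real.exp (gibbsWeight s p i) = (s.card * p i + 1) / 2 :=
    Real.exp_log (by have := hp i; positivity)
  simp only [hexp, ← Finset.sum_div, Finset.sum_add_distrib, ← Finset.mul_sum, hsum,
    Finset.sum_const, nsmul_eq_mul]
  ring

theorem sum_mul_gibbsWeight_pos (hp : ∀ i, 0 ≤ p i) (hsum : ∑ i ∈ s, p i = 1)
    (hne : ∃ i ∈ s, p i ≠ 1 / s.card) : 0 < ∑ i ∈ s, p i * gibbsWeight s p i := by
  obtain ⟨i₀, hi₀, hne⟩ := hne
  have hM : (0 : ℝ) < s.card := Nat.cast_pos.2 (Finset.card_pos.2 ⟨i₀, hi₀⟩)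
  set M : ℝ := (s.card : ℝ)
  -- `log y ≥ 1 - y⁻¹` at `y = (M p + 1) / 2`; the linear terms sum to zero.
  have hlog (i : ι) : (p i - 1 / M) / 2 + (M * p i - 1) ^ 2 / (2 * M * (M * p i + 1)) ≤
      p i * gibbsWeight s p i := by
    have hi := hp i
    refine le_trans (le_of_eq ?_) (mul_le_mul_of_nonneg_left
      (Real.one_sub_inv_le_log_of_pos (x := (M * p i + 1) / 2) (by positivity)) hi)
    field_simp
    ring
  have hlinear : ∑ i ∈ s, (p i - 1 / M) / 2 = 0 := by
    rw [← Finset.sum_div, Finset.sum_sub_distrib, hsum, Finset.sum_const, nsmul_eq_mul,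
      mul_one_div_cancel hM.ne', sub_self, zero_div]
  have hsquare : 0 < ∑ i ∈ s, (M * p i - 1) ^ 2 / (2 * M * (M * p i + 1)) := by
    refine Finset.sum_pos' (fun i _ ↦ by have := hp i; positivity) ⟨i₀, hi₀, ?_⟩
    have hi₀' := hp i₀
    have : M * p i₀ - 1 ≠ 0 := sub_ne_zero.2 fun h ↦ hne (eq_one_div_of_mul_eq_one_right h)
    positivity
  calc 0 < ∑ i ∈ s, ((p i - 1 / M) / 2 + (M * p i - 1) ^ 2 / (2 * M * (M * p i + 1))) := by
        rwa [Finset.sum_add_distrib, hlinear, zero_add]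
    _ ≤ _ := Finset.sum_le_sum fun i _ ↦ hlog i

theorem exists_lt_mul_rpow_lt_one {r d : ℝ≥0} (hd : 0 < d) {K : ℝ} (h : K * (r : ℝ) ^ (d : ℝ) < 1) :
    ∃ t : ℝ≥0, 0 < t ∧ t < d ∧ K * (r : ℝ) ^ (t : ℝ) < 1 := by
  have hcont : ContinuousAt (fun t : ℝ ↦ K * (r : ℝ) ^ t) d :=
    (Real.continuousAt_const_rpow' (NNReal.coe_ne_zero.2 hd.ne')).const_mul K
  obtain ⟨t, ht, h0, htd⟩ := (((hcont.eventually_lt_const h).filter_mono nhdsWithin_le_nhds).and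
    (Ioo_mem_nhdsLT (NNReal.coe_pos.2 hd))).exists
  lift t to ℝ≥0 using h0.le
  exact ⟨t, NNReal.coe_pos.1 h0, NNReal.coe_lt_coe.1 htd, ht⟩

variable {α : Type*} [MeasurableSpace α] {m : Measure α} [MeasurableSpace ι]
  [DiscreteMeasurableSpace ι] {c : α → ι}

theorem sum_measureReal_preimage_singleton_eq_one [IsProbabilityMeasure m] (hc : Measurable c)
    (hs : ∀ᵐ x ∂m, c x ∈ s) : ∑ i ∈ s, m.real (c ⁻¹' {i}) = 1 := by
  have huniv : c ⁻¹' (s : Set ι) =ᵐ[m] univ := eventuallyEq_univ.2 hs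
  rw [sum_measureReal_preimage_singleton s fun i _ ↦ hc (.singleton i), measureReal_congr huniv,
    probReal_univ]

theorem integrable_comp_of_ae_mem_finset [IsFiniteMeasure m] (hc : Measurable c)
    (hs : ∀ᵐ x ∂m, c x ∈ s) (f : ι → ℝ) : Integrable (f ∘ c) m := by
  refine Integrable.of_bound
    ((Measurable.of_discrete (f := f)).comp hc).aestronglyMeasurable (∑ i ∈ s, ‖f i‖) ?_
  filter_upwards [hs] with x hx
  exact Finset.single_le_sum (f := fun i ↦ ‖f i‖) (fun i _ ↦ norm_nonneg _) hx

theorem integral_comp_eq_sum_of_ae_mem_finset [IsFiniteMeasure m] (hc : Measurable c)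
    (hs : ∀ᵐ x ∂m, c x ∈ s) (f : ι → ℝ) :
    ∫ x, f (c x) ∂m = ∑ i ∈ s, m.real (c ⁻¹' {i}) * f i := by
  have hsm : ∀ᵐ i ∂m.map c, i ∈ (s : Set ι) := (ae_map_iff hc.aemeasurable .of_discrete).2 hs
  have hf : AEStronglyMeasurable f (m.map c) := Measurable.of_discrete.aestronglyMeasurable
  have hint : Integrable f (m.map c) :=
    (integrable_map_measure hf hc.aemeasurable).2 (integrable_comp_of_ae_mem_finset hc hs f)
  rw [← integral_map hc.aemeasurable hf, ← Measure.restrict_eq_self_of_ae_mem hsm,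
    setIntegral_finset s hint.integrableOn]
  simp only [map_measureReal_apply hc (.singleton _), smul_eq_mul]

variable {X : Type*} [EMetricSpace X] [MeasurableSpace X] [BorelSpace X] {m : Measure X}
  [IsProbabilityMeasure m] {T : X → X} {c : X → ι} {r d : ℝ≥0}

theorem PiecewiseAntilipschitzWith.measureDimH_lt_of_integral_pos
    (hT : PiecewiseAntilipschitzWith r c T) (hX : Metric.ediam (univ : Set X) ≠ ⊤)
    (hm : MeasurePreserving T m m) (hc : Measurable c) (hs : ∀ᵐ x ∂m, c x ∈ s) (hd : 0 < d)
    (f : ι → ℝ) (hf : (∑ i ∈ s, Real.exp (f i)) * (r : ℝ) ^ (d : ℝ) ≤ 1)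
    (hmean : 0 < ∫ x, f (c x) ∂m) : measureDimH m < d := by
  obtain ⟨a, ha, hamean⟩ := exists_between hmean
  have hpressure : (∑ i ∈ s, Real.exp (f i - a)) * (r : ℝ) ^ (d : ℝ) < 1 := by
    simp only [Real.exp_sub, ← Finset.sum_div]
    rw [div_mul_eq_mul_div]
    exact (div_lt_one (Real.exp_pos a)).2 (hf.trans_lt (Real.one_lt_exp_iff.2 ha))
  obtain ⟨t, ht, htd, hpressure_t⟩ := exists_lt_mul_rpow_lt_one hd hpressure
  have hbound : ∀ᵐ x ∂m, (f ∘ c) x ≤ ∑ i ∈ s, |f i| := by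
    filter_upwards [hs] with x hx
    exact (le_abs_self _).trans
      (Finset.single_le_sum (f := fun i ↦ |f i|) (fun i _ ↦ abs_nonneg _) hx)
  have hpos := measure_limsup_le_birkhoffSum_pos hm (integrable_comp_of_ae_mem_finset hc hs f)
    hbound hamean
  set L : Set X := limsup (fun k : ℕ ↦ {x | k * a ≤ birkhoffSum T (f ∘ c) k x}) atTop
  have hL : MeasurableSet L := .measurableSet_limsup fun k ↦ measurableSet_le measurable_const
    (Finset.measurable_sum _ fun j _ ↦
      (Measurable.of_discrete (f := f)).comp (hc.comp (hm.measurable.iterate j)))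
  have hS : ∀ᵐ x ∂m, x ∈ {x | ∀ j, c (T^[j] x) ∈ s} :=
    ae_all_iff.2 fun j ↦ (hm.iterate j).quasiMeasurePreserving.ae hs
  have hSm : MeasurableSet {x | ∀ j, c (T^[j] x) ∈ s} := by
    rw [ofPred_forall]
    exact .iInter fun j ↦ (hc.comp (hm.measurable.iterate j)) .of_discrete
  refine measureDimH_lt_iff.2 ⟨{x | ∀ j, c (T^[j] x) ∈ s} ∩ L, hSm.inter hL, ?_, ?_⟩
  · rwa [Measure.measure_inter_eq_of_ae hS]
  · refine (dimH_mono fun x hx ↦ ?_).trans_lt ((hT.dimH_frequently_le_birkhoffSum_le hX s f a ht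
      hpressure_t).trans_lt (ENNReal.coe_lt_coe.2 htd))
    exact ⟨hx.1, mem_limsup_iff_frequently_mem.1 hx.2⟩

theorem PiecewiseAntilipschitzWith.measureDimH_lt_of_measureReal_ne
    (hT : PiecewiseAntilipschitzWith r c T) (hX : Metric.ediam (univ : Set X) ≠ ⊤)
    (hm : MeasurePreserving T m m) (hc : Measurable c) (hs : ∀ᵐ x ∂m, c x ∈ s) (hd : 0 < d)
    (hsd : s.card * (r : ℝ) ^ (d : ℝ) ≤ 1) (hne : ∃ i ∈ s, m.real (c ⁻¹' {i}) ≠ 1 / s.card) :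
    measureDimH m < d := by
  have hp (i : ι) : 0 ≤ m.real (c ⁻¹' {i}) := measureReal_nonneg
  have hpsum := sum_measureReal_preimage_singleton_eq_one hc hs
  refine hT.measureDimH_lt_of_integral_pos hX hm hc hs hd
    (gibbsWeight s fun i ↦ m.real (c ⁻¹' {i})) (by rwa [sum_exp_gibbsWeight hp hpsum]) ?_
  rw [integral_comp_eq_sum_of_ae_mem_finset hc hs]
  exact sum_mul_gibbsWeight_pos hp hpsum hne

end Entropy

section Circle

/-- The projection of the unit interval onto the circle, which identifies the endpoints. -/
noncomputable def toCircle (x : I) : UnitAddCircle :=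
  (x : ℝ)

/-- The representative in `[0, 1)` of a point of the circle, as a point of the unit interval. -/
noncomputable def ofCircle (z : UnitAddCircle) : I :=
  ⟨AddCircle.measurableEquivIco 1 0 z, by
    have hz := (AddCircle.measurableEquivIco (1 : ℝ) 0 z).2
    exact ⟨hz.1, hz.2.le.trans_eq (zero_add 1)⟩⟩

theorem continuous_toCircle : Continuous toCircle :=
  (AddCircle.continuous_mk' 1).comp continuous_subtype_val

theorem measurable_ofCircle : Measurable ofCircle :=
  (measurable_subtype_coe.comp (AddCircle.measurableEquivIco (1 : ℝ) 0).measurable).subtype_mk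

@[simp]
theorem toCircle_ofCircle (z : UnitAddCircle) : toCircle (ofCircle z) = z :=
  AddCircle.coe_equivIco

theorem coe_ofCircle_coe (t : ℝ) : (ofCircle t : ℝ) = Int.fract t :=
  (AddCircle.coe_equivIco_mk_apply 1 t).trans (by rw [div_one, mul_one])

theorem ofCircle_ne_one (z : UnitAddCircle) : ofCircle z ≠ 1 := fun h ↦
  (AddCircle.measurableEquivIco (1 : ℝ) 0 z).2.2.ne
    ((congrArg Subtype.val h).trans (zero_add 1).symm)

theorem ofCircle_toCircle {x : I} (hx : x ≠ 1) : ofCircle (toCircle x) = x := by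
  ext
  rw [toCircle, coe_ofCircle_coe, Int.fract_eq_self]
  exact ⟨x.2.1, unitInterval.lt_one_iff_ne_one.2 hx⟩

theorem measurePreserving_toCircle : MeasurePreserving toCircle volume volume := by
  have h := UnitAddCircle.measurePreserving_mk 0
  rw [zero_add, Measure.restrict_congr_set Ioc_ae_eq_Icc] at h
  exact h.comp unitInterval.measurePreserving_coe

theorem measurePreserving_ofCircle : MeasurePreserving ofCircle volume volume := by
  have hinv : ofCircle ∘ toCircle =ᵐ[volume] id := by
    filter_upwards [compl_mem_ae_iff.2 (measure_singleton (1 : I))] with x hx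
    exact ofCircle_toCircle hx
  refine ⟨measurable_ofCircle, ?_⟩
  rw [← measurePreserving_toCircle.map_eq,
    Measure.map_map measurable_ofCircle continuous_toCircle.measurable, Measure.map_congr hinv,
    Measure.map_id]

theorem edist_ofCircle_eq_of_floor_eq {s t : ℝ} (h : ⌊s⌋ = ⌊t⌋) :
    edist (ofCircle s) (ofCircle t) = edist s t := by
  rw [Subtype.edist_eq, coe_ofCircle_coe, coe_ofCircle_coe, edist_dist, edist_dist, Real.dist_eq,
    Real.dist_eq, Int.fract, Int.fract, h, sub_sub_sub_cancel_right]

theorem piecewiseAntilipschitzWith_ofCircle_comp {X : Type*} [EMetricSpace X] {K : ℝ≥0}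
    {f : X → ℝ} (hf : AntilipschitzWith K f) :
    PiecewiseAntilipschitzWith K (fun x ↦ ⌊f x⌋) (fun x ↦ ofCircle (f x)) := fun x y hxy ↦ by
  rw [edist_ofCircle_eq_of_floor_eq hxy]
  exact hf x y

theorem dimH_preimage_ofCircle_coe_le (A : Set I) :
    dimH ((fun t : ℝ ↦ ofCircle t) ⁻¹' A) ≤ dimH A :=
  (piecewiseAntilipschitzWith_ofCircle_comp AntilipschitzWith.id).dimH_preimage_le A

end Circle

section TimesMap

theorem timesMap_eq_ofCircle_coe (N : ℕ) (x : I) : timesMap N x = ofCircle (N * x : ℝ) :=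
  Subtype.ext (coe_ofCircle_coe _).symm

theorem timesMap_eq_ofCircle_nsmul (N : ℕ) (x : I) :
    timesMap N x = ofCircle (N • toCircle x) := by
  rw [timesMap_eq_ofCircle_coe, ← nsmul_eq_mul, AddCircle.coe_nsmul, toCircle]

@[simp]
theorem toCircle_timesMap (N : ℕ) (x : I) : toCircle (timesMap N x) = N • toCircle x := by
  rw [timesMap_eq_ofCircle_nsmul, toCircle_ofCircle]

theorem iterate_timesMap_succ (N n : ℕ) : (timesMap N)^[n + 1] = timesMap (N ^ (n + 1)) := by
  funext x
  induction n with
  | zero => simp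
  | succ n ih =>
    rw [Function.iterate_succ_apply', ih, timesMap_eq_ofCircle_nsmul, toCircle_timesMap,
      smul_smul, ← pow_succ', ← timesMap_eq_ofCircle_nsmul]

theorem measurePreserving_timesMap_volume {N : ℕ} (hN : 1 < N) :
    MeasurePreserving (timesMap N) volume volume := by
  rw [funext (timesMap_eq_ofCircle_nsmul N)]
  exact measurePreserving_ofCircle.comp
    ((AddCircle.ergodic_nsmul hN).toMeasurePreserving.comp measurePreserving_toCircle)

theorem measure_singleton_one_eq_zero {N : ℕ} {m : Measure I}
    (hm : MeasurePreserving (timesMap N) m m) : m {1} = 0 := by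
  have hempty : timesMap N ⁻¹' {1} = ∅ := eq_empty_of_forall_notMem fun x hx ↦
    ofCircle_ne_one _ ((timesMap_eq_ofCircle_nsmul N x).symm.trans hx)
  rw [← hm.measure_preimage (measurableSet_singleton 1).nullMeasurableSet, hempty, measure_empty]

/-- The first digit of the expansion of `x` in base `M`. It takes the value `M` at `x = 1`. -/
noncomputable def digit (M : ℕ) (x : I) : ℤ :=
  ⌊(M * x : ℝ)⌋

theorem measurable_digit (M : ℕ) : Measurable (digit M) :=
  (measurable_subtype_coe.const_mul _).floor

theorem digit_mem_Ico {M : ℕ} (hM : 0 < M) {x : I} (hx : x ≠ 1) :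
    digit M x ∈ Finset.Ico 0 (M : ℤ) := by
  have hM' : (0 : ℝ) < M := Nat.cast_pos.2 hM
  refine Finset.mem_Ico.2 ⟨Int.floor_nonneg.2 (mul_nonneg hM'.le x.2.1), Int.floor_lt.2 ?_⟩
  exact mul_lt_of_lt_one_right hM' (unitInterval.lt_one_iff_ne_one.2 hx)

theorem piecewiseAntilipschitzWith_timesMap {N : ℕ} (hN : N ≠ 0) :
    PiecewiseAntilipschitzWith (N : ℝ≥0)⁻¹ (digit N) (timesMap N) := by
  have hmul : AntilipschitzWith (N : ℝ≥0)⁻¹ fun x : I ↦ (N * x : ℝ) :=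
    AntilipschitzWith.of_le_mul_dist fun x y ↦ le_of_eq <| by
      rw [Real.dist_eq, ← mul_sub, abs_mul, Nat.abs_cast, NNReal.coe_inv, NNReal.coe_natCast,
        inv_mul_cancel_left₀ (Nat.cast_ne_zero.2 hN), Subtype.dist_eq, Real.dist_eq]
  rw [funext (timesMap_eq_ofCircle_coe N)]
  exact piecewiseAntilipschitzWith_ofCircle_comp hmul

theorem tendsto_digit_div {M : ℕ → ℕ} (hM : Tendsto M atTop atTop) (x : I) :
    Tendsto (fun n ↦ (digit (M n) x / M n : ℝ)) atTop (𝓝 x) := by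
  refine ((tendsto_nat_floor_mul_div_atTop x.2.1).comp
    (tendsto_natCast_atTop_atTop.comp hM)).congr fun n ↦ ?_
  simp only [Function.comp_apply, digit, mul_comm (M n : ℝ),
    natCast_floor_eq_intCast_floor (mul_nonneg x.2.1 (M n).cast_nonneg)]

theorem tendsto_integral_comp_digit {M : ℕ → ℕ} (hM : Tendsto M atTop atTop) (m : Measure I)
    [IsFiniteMeasure m] (f : BoundedContinuousFunction I ℝ) :
    Tendsto (fun n ↦ ∫ d, f (projIcc 0 1 zero_le_one (d / M n : ℝ)) ∂m.map (digit (M n))) atTop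
      (𝓝 (∫ x, f x ∂m)) := by
  have hmap (n : ℕ) : ∫ d, f (projIcc 0 1 zero_le_one (d / M n : ℝ)) ∂m.map (digit (M n)) =
      ∫ x, f (projIcc 0 1 zero_le_one (digit (M n) x / M n : ℝ)) ∂m :=
    integral_map (measurable_digit _).aemeasurable Measurable.of_discrete.aestronglyMeasurable
  simp only [hmap]
  refine tendsto_integral_of_dominated_convergence (fun _ ↦ ‖f‖)
    (fun n ↦ ((Measurable.of_discrete (f := fun d : ℤ ↦
      f (projIcc 0 1 zero_le_one (d / M n : ℝ)))).comp (measurable_digit _)).aestronglyMeasurable)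
    (integrable_const _) (fun n ↦ .of_forall fun x ↦ f.norm_coe_le_norm _)
    (.of_forall fun x ↦ ?_)
  have hf : Continuous fun t : ℝ ↦ f (projIcc 0 1 zero_le_one t) := by fun_prop
  simpa only [projIcc_val, Function.comp_def] using (hf.tendsto x).comp (tendsto_digit_div hM x)

theorem ext_of_map_digit_eq {M : ℕ → ℕ} (hM : Tendsto M atTop atTop) {m m' : Measure I}
    [IsFiniteMeasure m] [IsFiniteMeasure m'] (h : ∀ n, m.map (digit (M n)) = m'.map (digit (M n))) :
    m = m' := by
  refine ext_of_forall_integral_eq_of_IsFiniteMeasure fun f ↦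
    tendsto_nhds_unique (tendsto_integral_comp_digit hM m f) ?_
  simp only [h]
  exact tendsto_integral_comp_digit hM m' f

variable {m m' : Measure I} [IsProbabilityMeasure m] [IsProbabilityMeasure m']

theorem measureReal_preimage_digit {M : ℕ} (hM : 0 < M) (hm : MeasurePreserving (timesMap M) m m)
    (hdim : 1 ≤ measureDimH m) (d : ℤ) :
    m.real (digit M ⁻¹' {d}) = if d ∈ Finset.Ico 0 (M : ℤ) then 1 / (M : ℝ) else 0 := by
  have hs : ∀ᵐ x ∂m, digit M x ∈ Finset.Ico 0 (M : ℤ) := by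
    filter_upwards [compl_mem_ae_iff.2 (measure_singleton_one_eq_zero hm)] with x hx
    exact digit_mem_Ico hM hx
  split_ifs with hd
  · by_contra hne
    have hcard : (Finset.Ico 0 (M : ℤ)).card = M := by simp
    have hcontract : (Finset.Ico 0 (M : ℤ)).card * ((M : ℝ≥0)⁻¹ : ℝ) ^ ((1 : ℝ≥0) : ℝ) ≤ 1 := by
      simp [hcard, hM.ne']
    exact hdim.not_gt ((piecewiseAntilipschitzWith_timesMap hM.ne').measureDimH_lt_of_measureReal_ne
      Metric.isBounded_of_compactSpace.ediam_ne_top hm (measurable_digit M) hs one_pos hcontract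
      ⟨d, hd, by rwa [hcard]⟩)
  · rw [measureReal_eq_zero_iff, measure_eq_zero_iff_ae_notMem]
    filter_upwards [hs] with x hx hxd
    exact hd (hxd ▸ hx)

theorem map_digit_eq_map_digit {M : ℕ} (hM : 0 < M) (hm : MeasurePreserving (timesMap M) m m)
    (hm' : MeasurePreserving (timesMap M) m' m') (hdim : 1 ≤ measureDimH m)
    (hdim' : 1 ≤ measureDimH m') : m.map (digit M) = m'.map (digit M) := by
  refine ext_iff_measureReal_singleton.2 fun d ↦ ?_
  rw [map_measureReal_apply (measurable_digit M) (.singleton d),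
    map_measureReal_apply (measurable_digit M) (.singleton d),
    measureReal_preimage_digit hM hm hdim, measureReal_preimage_digit hM hm' hdim']

theorem one_le_measureDimH_volume : 1 ≤ measureDimH (volume : Measure I) :=
  isFrostman_volume_unitInterval.le_measureDimH

theorem eq_volume_of_one_le_measureDimH {N : ℕ} (hN : 1 < N)
    (hm : MeasurePreserving (timesMap N) m m) (hdim : 1 ≤ measureDimH m) : m = volume := by
  refine ext_of_map_digit_eq (M := fun n ↦ N ^ (n + 1))
    ((tendsto_pow_atTop_atTop_of_one_lt hN).comp (tendsto_add_atTop_nat 1)) fun n ↦ ?_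
  refine map_digit_eq_map_digit (Nat.pow_pos (Nat.zero_lt_of_lt hN)) ?_ ?_ hdim
    one_le_measureDimH_volume
  · exact iterate_timesMap_succ N n ▸ hm.iterate (n + 1)
  · exact measurePreserving_timesMap_volume (Nat.one_lt_pow n.succ_ne_zero hN)

end TimesMap

section FourierStieltjes

/-- The Fourier–Stieltjes coefficient `∫ e(p x) dm(x)` of a measure on the unit interval. -/
noncomputable def fourierStieltjes (m : Measure I) (p : ℤ) : ℂ :=
  ∫ x, fourier p (toCircle x) ∂m

/-- The Fourier–Stieltjes coefficient `∫ e(p x₁ + q x₂) dP(x)` of a measure on the unit square. -/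
noncomputable def fourierStieltjes₂ (P : Measure (I × I)) (p q : ℤ) : ℂ :=
  ∫ x, fourier p (toCircle x.1) * fourier q (toCircle x.2) ∂P

theorem continuous_fourier_toCircle (p : ℤ) : Continuous fun x ↦ fourier p (toCircle x) :=
  (map_continuous _).comp continuous_toCircle

theorem fourierStieltjes_zero (m : Measure I) [IsProbabilityMeasure m] :
    fourierStieltjes m 0 = 1 := by
  simp [fourierStieltjes]

theorem fourierStieltjes_volume {p : ℤ} (hp : p ≠ 0) : fourierStieltjes volume p = 0 := by
  rw [fourierStieltjes, ← integral_map continuous_toCircle.aemeasurable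
    (map_continuous (fourier p)).aestronglyMeasurable, measurePreserving_toCircle.map_eq]
  exact integral_eq_zero_of_add_right_eq_neg (fourier_add_half_inv_index hp one_pos)

theorem fourierStieltjes₂_zero_right (P : Measure (I × I)) (p : ℤ) :
    fourierStieltjes₂ P p 0 = fourierStieltjes P.fst p := by
  simp only [fourierStieltjes₂, fourierStieltjes, Measure.fst, fourier_zero, mul_one]
  exact (integral_map measurable_fst.aemeasurable
    (continuous_fourier_toCircle p).aestronglyMeasurable).symm

theorem fourierStieltjes₂_zero_left (P : Measure (I × I)) (q : ℤ) :
    fourierStieltjes₂ P 0 q = fourierStieltjes P.snd q := by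
  simp only [fourierStieltjes₂, fourierStieltjes, Measure.snd, fourier_zero, one_mul]
  exact (integral_map measurable_snd.aemeasurable
    (continuous_fourier_toCircle q).aestronglyMeasurable).symm

theorem fourierStieltjes₂_prod (m m' : Measure I) [SFinite m] [SFinite m'] (p q : ℤ) :
    fourierStieltjes₂ (m.prod m') p q = fourierStieltjes m p * fourierStieltjes m' q :=
  integral_prod_mul (fun x ↦ fourier p (toCircle x)) fun x ↦ fourier q (toCircle x)

theorem integrable_fourier_mul_fourier (P : Measure (I × I)) [IsFiniteMeasure P] (p q : ℤ) :
    Integrable (fun x ↦ fourier p (toCircle x.1) * fourier q (toCircle x.2)) P :=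
  Integrable.of_bound (((continuous_fourier_toCircle p).comp continuous_fst).mul
    ((continuous_fourier_toCircle q).comp continuous_snd)).aestronglyMeasurable 1
    (.of_forall fun x ↦ by
      rw [norm_mul, fourier_apply, fourier_apply, Circle.norm_coe, Circle.norm_coe, mul_one])

theorem fourierStieltjes₂_add (P Q : Measure (I × I)) [IsFiniteMeasure P] [IsFiniteMeasure Q]
    (p q : ℤ) :
    fourierStieltjes₂ (P + Q) p q = fourierStieltjes₂ P p q + fourierStieltjes₂ Q p q :=
  integral_add_measure (integrable_fourier_mul_fourier P p q)
    (integrable_fourier_mul_fourier Q p q)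

theorem ext_of_integral_mFourier {d : Type*} [Fintype d] {P Q : Measure (UnitAddTorus d)}
    [IsFiniteMeasure P] [IsFiniteMeasure Q]
    (h : ∀ n : d → ℤ, ∫ x, UnitAddTorus.mFourier n x ∂P = ∫ x, UnitAddTorus.mFourier n x ∂Q) :
    P = Q := by
  have hint (R : Measure (UnitAddTorus d)) [IsFiniteMeasure R] (f : C(UnitAddTorus d, ℂ)) :
      Integrable f R := (BoundedContinuousFunction.mkOfCompact f).integrable R
  have hspan : ∀ f ∈ Submodule.span ℂ (range (UnitAddTorus.mFourier (d := d))),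
      ∫ x, f x ∂P = ∫ x, f x ∂Q := fun f hf ↦ by
    induction hf using Submodule.span_induction with
    | mem f hf => obtain ⟨n, rfl⟩ := hf; exact h n
    | zero => simp
    | add f g _ _ hf hg =>
      simp only [ContinuousMap.add_apply, integral_add (hint P f) (hint P g),
        integral_add (hint Q f) (hint Q g), hf, hg]
    | smul c f _ hf => simp only [ContinuousMap.smul_apply, integral_smul, hf]
  refine ext_of_forall_mem_subalgebra_integral_eq_of_pseudoEMetric_complete_countable (𝕜 := ℂ)
    (A := (UnitAddTorus.mFourierSubalgebra d).comap
      (BoundedContinuousFunction.toContinuousMapStarₐ ℂ)) ?_ fun f hf ↦ hspan f ?_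
  · intro x y hxy
    obtain ⟨_, ⟨f, hf, rfl⟩, hne⟩ := UnitAddTorus.mFourierSubalgebra_separatesPoints hxy
    exact ⟨_, ⟨f, ⟨BoundedContinuousFunction.mkOfCompact f, hf, by ext; rfl⟩, rfl⟩, hne⟩
  · rw [← UnitAddTorus.mFourierSubalgebra_coe]
    exact hf

/-- The projection of the unit square onto the two-dimensional torus. -/
noncomputable def toTorus (x : I × I) : UnitAddTorus (Fin 2) :=
  ![toCircle x.1, toCircle x.2]

theorem continuous_toTorus : Continuous toTorus :=
  continuous_pi <| Fin.forall_fin_two.2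
    ⟨continuous_toCircle.comp continuous_fst, continuous_toCircle.comp continuous_snd⟩

/-- The identification of the two-dimensional torus with `[0,1)²`. -/
noncomputable def ofTorus (z : UnitAddTorus (Fin 2)) : I × I :=
  (ofCircle (z 0), ofCircle (z 1))

theorem measurable_ofTorus : Measurable ofTorus :=
  (measurable_ofCircle.comp (measurable_pi_apply 0)).prodMk
    (measurable_ofCircle.comp (measurable_pi_apply 1))

theorem integral_mFourier_map_toTorus (P : Measure (I × I)) (n : Fin 2 → ℤ) :
    ∫ z, UnitAddTorus.mFourier n z ∂P.map toTorus = fourierStieltjes₂ P (n 0) (n 1) := by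
  rw [integral_map continuous_toTorus.aemeasurable (map_continuous _).aestronglyMeasurable]
  simp only [UnitAddTorus.mFourier, toTorus, ContinuousMap.coe_mk, Fin.prod_univ_two,
    Matrix.cons_val_zero, Matrix.cons_val_one, fourierStieltjes₂]

theorem map_ofCircle_map_toTorus {P : Measure (I × I)} (hP : ∀ᵐ x ∂P, x.1 ≠ 1 ∧ x.2 ≠ 1) :
    (P.map toTorus).map ofTorus = P := by
  have hinv : ofTorus ∘ toTorus =ᵐ[P] id := by
    filter_upwards [hP] with x hx
    exact Prod.ext (ofCircle_toCircle hx.1) (ofCircle_toCircle hx.2)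
  rw [Measure.map_map measurable_ofTorus continuous_toTorus.measurable, Measure.map_congr hinv,
    Measure.map_id]

theorem ext_of_fourierStieltjes₂_eq {P Q : Measure (I × I)} [IsFiniteMeasure P]
    [IsFiniteMeasure Q] (hP : ∀ᵐ x ∂P, x.1 ≠ 1 ∧ x.2 ≠ 1) (hQ : ∀ᵐ x ∂Q, x.1 ≠ 1 ∧ x.2 ≠ 1)
    (h : ∀ p q, fourierStieltjes₂ P p q = fourierStieltjes₂ Q p q) : P = Q := by
  have hmap : P.map toTorus = Q.map toTorus := ext_of_integral_mFourier fun n ↦ by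
    rw [integral_mFourier_map_toTorus, integral_mFourier_map_toTorus, h]
  rw [← map_ofCircle_map_toTorus hP, hmap, map_ofCircle_map_toTorus hQ]

end FourierStieltjes

section IntegerProjections

/-- The map `x ↦ p x₁ + q x₂ mod 1` on the unit square. -/
noncomputable def combMod (p q : ℤ) (x : I × I) : I :=
  ofCircle (p • toCircle x.1 + q • toCircle x.2)

theorem measurable_combMod (p q : ℤ) : Measurable (combMod p q) :=
  measurable_ofCircle.comp (((continuous_toCircle.comp continuous_fst).zsmul p).add
    ((continuous_toCircle.comp continuous_snd).zsmul q)).measurable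

theorem combMod_eq_ofCircle_coe_proj (p q : ℤ) (x : I × I) :
    combMod p q x = ofCircle (proj ((p : ℝ), (q : ℝ)) x) := by
  rw [combMod, proj, mul_comm, ← zsmul_eq_mul, mul_comm, ← zsmul_eq_mul, AddCircle.coe_add,
    AddCircle.coe_zsmul, AddCircle.coe_zsmul, toCircle, toCircle]

theorem semiconj_combMod (N : ℕ) (p q : ℤ) :
    Function.Semiconj (combMod p q) (timesMap₂ N) (timesMap N) := fun x ↦ by
  rw [timesMap_eq_ofCircle_nsmul, combMod, combMod, toCircle_ofCircle, timesMap₂,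
    toCircle_timesMap, toCircle_timesMap, smul_add, smul_comm p, smul_comm q]

theorem measureDimH_map_proj_le_measureDimH_map_combMod (P : Measure (I × I)) (p q : ℤ) :
    measureDimH (P.map (proj ((p : ℝ), (q : ℝ)))) ≤ measureDimH (P.map (combMod p q)) := by
  have hmk : Measurable fun t : ℝ ↦ ofCircle t := measurable_ofCircle.comp AddCircle.measurable_mk'
  rw [funext (combMod_eq_ofCircle_coe_proj p q),
    ← Function.comp_def (fun t : ℝ ↦ ofCircle t) (proj _),
    ← Measure.map_map hmk (measurable_proj _)]
  exact measureDimH_le_measureDimH_map hmk dimH_preimage_ofCircle_coe_le _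

theorem fourierStieltjes_map_combMod (P : Measure (I × I)) (p q : ℤ) :
    fourierStieltjes (P.map (combMod p q)) 1 = fourierStieltjes₂ P p q := by
  rw [fourierStieltjes, integral_map (measurable_combMod p q).aemeasurable
    (continuous_fourier_toCircle 1).aestronglyMeasurable]
  simp only [combMod, toCircle_ofCircle, fourier_apply, one_smul, AddCircle.toCircle_add,
    Circle.coe_mul, fourierStieltjes₂]

variable {N : ℕ} {μ : Measure (I × I)} [IsProbabilityMeasure μ]

theorem map_combMod_eq_volume (hN : 1 < N) (hμ : MeasurePreserving (timesMap₂ N) μ μ) {p q : ℤ}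
    (h : 1 ≤ measureDimH (μ.map (proj ((p : ℝ), (q : ℝ))))) : μ.map (combMod p q) = volume := by
  have hm := measurable_combMod p q
  have := Measure.isProbabilityMeasure_map (μ := μ) hm.aemeasurable
  exact eq_volume_of_one_le_measureDimH hN
    ((hm.measurePreserving μ).of_semiconj hμ (semiconj_combMod N p q) (measurable_timesMap N))
    (h.trans (measureDimH_map_proj_le_measureDimH_map_combMod μ p q))

theorem fourierStieltjes₂_eq_zero (hN : 1 < N) (hμ : MeasurePreserving (timesMap₂ N) μ μ) {p q : ℤ}
    (h : 1 ≤ measureDimH (μ.map (proj ((p : ℝ), (q : ℝ))))) : fourierStieltjes₂ μ p q = 0 := by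
  rw [← fourierStieltjes_map_combMod, map_combMod_eq_volume hN hμ h,
    fourierStieltjes_volume one_ne_zero]

end IntegerProjections

section Rigidity

theorem ae_prod_ne_one {m m' : Measure I} [SFinite m] [SFinite m'] (h : m {1} = 0)
    (h' : m' {1} = 0) : ∀ᵐ x ∂m.prod m', x.1 ≠ 1 ∧ x.2 ≠ 1 :=
  (Measure.quasiMeasurePreserving_fst.ae (compl_mem_ae_iff.2 h)).and
    (Measure.quasiMeasurePreserving_snd.ae (compl_mem_ae_iff.2 h'))

theorem add_volume_prod_volume_eq_of_fourierStieltjes₂_eq_zero {μ : Measure (I × I)}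
    [IsProbabilityMeasure μ] (h1 : μ.fst {1} = 0) (h2 : μ.snd {1} = 0)
    (h : ∀ p q, p ≠ 0 → q ≠ 0 → fourierStieltjes₂ μ p q = 0) :
    μ + (volume : Measure I).prod volume =
      μ.fst.prod volume + (volume : Measure I).prod μ.snd := by
  have hvol : (volume : Measure I) {1} = 0 := measure_singleton 1
  have hμ : ∀ᵐ x ∂μ, x.1 ≠ 1 ∧ x.2 ≠ 1 :=
    (ae_of_ae_map measurable_fst.aemeasurable (compl_mem_ae_iff.2 h1)).and
      (ae_of_ae_map measurable_snd.aemeasurable (compl_mem_ae_iff.2 h2))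
  refine ext_of_fourierStieltjes₂_eq (ae_add_measure_iff.2 ⟨hμ, ae_prod_ne_one hvol hvol⟩)
    (ae_add_measure_iff.2 ⟨ae_prod_ne_one h1 hvol, ae_prod_ne_one hvol h2⟩) fun p q ↦ ?_
  simp only [fourierStieltjes₂_add, fourierStieltjes₂_prod]
  rcases eq_or_ne p 0 with rfl | hp
  · rw [fourierStieltjes₂_zero_left, fourierStieltjes_zero, fourierStieltjes_zero, one_mul,
      one_mul, add_comm]
  rcases eq_or_ne q 0 with rfl | hq
  · rw [fourierStieltjes₂_zero_right, fourierStieltjes_zero, fourierStieltjes_zero, mul_one,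
      mul_one]
  · rw [h p q hp hq, fourierStieltjes_volume hp, fourierStieltjes_volume hq, zero_mul, zero_mul,
      mul_zero]

theorem eq_zero_of_add_prod_eq_of_mutuallySingular {X Y : Type*} [MeasurableSpace X]
    [MeasurableSpace Y] {P : Measure (X × Y)} {α : Measure X} {β : Measure Y} [SFinite P]
    [SFinite β] (h : P + α.prod β = P.fst.prod β + α.prod P.snd) (h1 : P.fst ⟂ₘ α)
    (h2 : P.snd ⟂ₘ β) : P = 0 := by
  obtain ⟨A, hA, hPA, hαA⟩ := h1
  obtain ⟨B, hB, hPB, hβB⟩ := h2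
  rw [Measure.fst_apply hA] at hPA
  rw [Measure.snd_apply hB] at hPB
  have hprod : P (Aᶜ ×ˢ Bᶜ) = 0 := by
    have := congrArg (· (Aᶜ ×ˢ Bᶜ)) h
    simp only [Measure.add_apply, Measure.prod_prod, hαA, hβB, mul_zero, zero_mul, add_zero] at this
    exact this
  refine Measure.measure_univ_eq_zero.1 (measure_mono_null (fun x _ ↦ ?_)
    (measure_union_null (measure_union_null hPA hPB) hprod))
  by_cases hxA : x.1 ∈ A
  · exact .inl (.inl hxA)
  by_cases hxB : x.2 ∈ B
  · exact .inl (.inr hxB)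
  · exact .inr ⟨hxA, hxB⟩

variable {N : ℕ}

theorem mutuallySingular_volume_of_ergodic_of_ne (hN : 1 < N) {m : Measure I}
    [IsProbabilityMeasure m] (hm : Ergodic (timesMap N) m) (hne : m ≠ volume) : m ⟂ₘ volume := by
  have hdim : measureDimH m < 1 :=
    not_le.1 fun h ↦ hne (eq_volume_of_one_le_measureDimH hN hm.toMeasurePreserving h)
  exact mutuallySingular_of_ergodic_of_measureDimH_lt hm
    (piecewiseAntilipschitzWith_timesMap (Nat.ne_zero_of_lt hN)).dimH_preimage_le
    (hdim.trans_le one_le_measureDimH_volume)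

variable {μ : Measure (I × I)}

theorem ergodic_fst (hμ : Ergodic (timesMap₂ N) μ) : Ergodic (timesMap N) μ.fst :=
  (measurable_fst.measurePreserving μ).ergodic_of_ergodic_semiconj hμ (measurable_timesMap N)
    fun _ ↦ rfl

theorem ergodic_snd (hμ : Ergodic (timesMap₂ N) μ) : Ergodic (timesMap N) μ.snd :=
  (measurable_snd.measurePreserving μ).ergodic_of_ergodic_semiconj hμ (measurable_timesMap N)
    fun _ ↦ rfl

theorem eq_fst_prod_volume_or_eq_volume_prod_snd [IsProbabilityMeasure μ] (hN : 1 < N)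
    (hμ : Ergodic (timesMap₂ N) μ)
    (h : ∀ p q : ℤ, p ≠ 0 → q ≠ 0 → 1 ≤ measureDimH (μ.map (proj ((p : ℝ), (q : ℝ))))) :
    μ = μ.fst.prod volume ∨ μ = (volume : Measure I).prod μ.snd := by
  have hfst := ergodic_fst hμ
  have hsnd := ergodic_snd hμ
  have hadd := add_volume_prod_volume_eq_of_fourierStieltjes₂_eq_zero
    (measure_singleton_one_eq_zero hfst.toMeasurePreserving)
    (measure_singleton_one_eq_zero hsnd.toMeasurePreserving)
    fun p q hp hq ↦ fourierStieltjes₂_eq_zero hN hμ.toMeasurePreserving (h p q hp hq)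
  by_cases h1 : μ.fst = volume
  · rw [h1, add_comm] at hadd
    exact .inr ((Measure.add_right_inj _ _ _).1 hadd)
  by_cases h2 : μ.snd = volume
  · rw [h2] at hadd
    exact .inl ((Measure.add_left_inj _ _ _).1 hadd)
  · exact absurd (eq_zero_of_add_prod_eq_of_mutuallySingular hadd
      (mutuallySingular_volume_of_ergodic_of_ne hN hfst h1)
      (mutuallySingular_volume_of_ergodic_of_ne hN hsnd h2)) (IsProbabilityMeasure.ne_zero μ)

end Rigidity

section Products

variable {ν : Measure I} {μ : Measure (I × I)}

theorem map_proj_prod_volume_absolutelyContinuous [SFinite ν] {v : ℝ × ℝ} (hv : v.2 ≠ 0) :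
    (ν.prod (volume : Measure I)).map (proj v) ≪ volume := by
  refine .mk fun S hS hS0 ↦ ?_
  rw [Measure.map_apply (measurable_proj v) hS, Measure.measure_prod_null (measurable_proj v hS)]
  refine .of_forall fun x ↦ ?_
  have hline : volume ((fun t : ℝ ↦ t * v.2) ⁻¹' ((fun t ↦ (x : ℝ) * v.1 + t) ⁻¹' S)) = 0 := by
    rw [Real.volume_preimage_mul_right hv, measure_preimage_add, hS0, mul_zero]
  change volume (Prod.mk x ⁻¹' (proj v ⁻¹' S)) = 0
  rw [unitInterval.volume_apply]
  exact measure_mono_null (by rintro _ ⟨y, hy, rfl⟩; exact hy) hline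

theorem map_swap_map_proj (P : Measure (I × I)) (v : ℝ × ℝ) :
    (P.map Prod.swap).map (proj v) = P.map (proj v.swap) := by
  rw [Measure.map_map (measurable_proj v) measurable_swap]
  congr 1
  funext x
  exact add_comm _ _

theorem measureDimH_eq_one_of_absolutelyContinuous {m : Measure ℝ} [NeZero m] (h : m ≪ volume) :
    measureDimH m = 1 :=
  le_antisymm ((measureDimH_le_dimH .univ (by simp [NeZero.pos])).trans_eq Real.dimH_univ)
    (isFrostman_volume_real.le_measureDimH.trans (measureDimH_le_of_absolutelyContinuous h))

theorem measureDimH_map_proj_eq_one [IsProbabilityMeasure ν] {v : ℝ × ℝ} (hv : NonPrincipal v)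
    (h : μ = ν.prod volume ∨ μ = (volume : Measure I).prod ν) :
    measureDimH (μ.map (proj v)) = 1 := by
  have hμ : IsProbabilityMeasure μ := by rcases h with rfl | rfl <;> infer_instance
  have := Measure.isProbabilityMeasure_map (μ := μ) (measurable_proj v).aemeasurable
  refine measureDimH_eq_one_of_absolutelyContinuous ?_
  rcases h with rfl | rfl
  · exact map_proj_prod_volume_absolutelyContinuous (right_ne_zero_of_mul hv)
  · rw [← Measure.prod_swap, map_swap_map_proj]
    exact map_proj_prod_volume_absolutelyContinuous (left_ne_zero_of_mul hv)

theorem measureDimH_le_measureDimH_map_swap {X Y : Type*} [EMetricSpace X] [MeasurableSpace X]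
    [BorelSpace X] [EMetricSpace Y] [MeasurableSpace Y] [BorelSpace Y]
    [SecondCountableTopology X] [SecondCountableTopology Y] (P : Measure (X × Y)) :
    measureDimH P ≤ measureDimH (P.map Prod.swap) := by
  have hswap : Isometry (Prod.swap : X × Y → Y × X) := fun x y ↦ max_comm _ _
  exact measureDimH_le_measureDimH_map measurable_swap
    (fun A ↦ by simpa using hswap.antilipschitz.dimH_preimage_le A) P

theorem measureDimH_eq_zero_of_eq_prod_volume [SFinite ν] (hμ : measureDimH μ ≤ 1)
    (h : μ = ν.prod volume ∨ μ = (volume : Measure I).prod ν) : measureDimH ν = 0 := by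
  have hprod : measureDimH ((volume : Measure I).prod ν) ≤ 1 := by
    rcases h with rfl | rfl
    · rw [← Measure.prod_swap] at hμ
      exact (measureDimH_le_measureDimH_map_swap _).trans hμ
    · exact hμ
  have hadd : 1 + measureDimH ν ≤ 1 + 0 :=
    (isFrostman_volume_unitInterval.add_measureDimH_le_measureDimH_prod ν).trans
      (hprod.trans_eq (add_zero 1).symm)
  exact le_zero_iff.1 ((ENNReal.add_le_add_iff_left ENNReal.one_ne_top).1 hadd)

end Products

end TimesN

theorem mainTheorem8_general (N : ℕ) (hN : 2 ≤ N) (μ : Measure (I × I)) [IsProbabilityMeasure μ]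
    (hμ : Ergodic (TimesN.timesMap₂ N) μ) :
    (∀ v : ℝ × ℝ, TimesN.NonPrincipal v → TimesN.measureDimH (μ.map (TimesN.proj v)) = 1) ↔
      ∃ ν : Measure I, IsProbabilityMeasure ν ∧ Ergodic (TimesN.timesMap N) ν ∧
        (μ = ν.prod (volume : Measure I) ∨ μ = (volume : Measure I).prod ν) := by
  constructor
  · intro h
    have hint (p q : ℤ) (hp : p ≠ 0) (hq : q ≠ 0) :
        1 ≤ TimesN.measureDimH (μ.map (TimesN.proj ((p : ℝ), (q : ℝ)))) :=
      (h _ (mul_ne_zero (Int.cast_ne_zero.2 hp) (Int.cast_ne_zero.2 hq))).ge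
    rcases TimesN.eq_fst_prod_volume_or_eq_volume_prod_snd hN hμ hint with heq | heq
    · exact ⟨μ.fst, inferInstance, TimesN.ergodic_fst hμ, .inl heq⟩
    · exact ⟨μ.snd, inferInstance, TimesN.ergodic_snd hμ, .inr heq⟩
  · rintro ⟨ν, _, -, h⟩ v hv
    exact TimesN.measureDimH_map_proj_eq_one hv h

theorem mainTheorem8 (N : ℕ) (hN : 2 ≤ N) (μ : Measure (I × I)) [IsProbabilityMeasure μ]
    (hμ : Ergodic (TimesN.timesMap₂ N) μ) (hdim : TimesN.measureDimH μ = 1) :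
    (∀ v : ℝ × ℝ, TimesN.NonPrincipal v → TimesN.measureDimH (μ.map (TimesN.proj v)) = 1) ↔
      ∃ ν : Measure I, IsProbabilityMeasure ν ∧ Ergodic (TimesN.timesMap N) ν ∧
        TimesN.measureDimH ν = 0 ∧
        (μ = ν.prod (volume : Measure I) ∨ μ = (volume : Measure I).prod ν) :=
  (mainTheorem8_general N hN μ hμ).trans <| exists_congr fun _ ↦
    ⟨fun ⟨hν, he, h⟩ ↦ ⟨hν, he, TimesN.measureDimH_eq_zero_of_eq_prod_volume hdim.le h, h⟩,
      fun ⟨hν, he, _, h⟩ ↦ ⟨hν, he, h⟩⟩
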